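/- Fix average SNRs $\rho>0$ (first hop) and $\rho_R>0$ (second hop). Consider $n$ source–destination pairs and $m$ relays, with channel power gains $\gamma_{i,r}$ from source $i$ to relay $r$ and $\xi_{k,j}$ from relay $k$ to destination $j$ ($1\le i,j\le n$, $1\le r,k\le m$), all i.i.d. $\mathrm{Exp}(1)$ (i.i.d. Rayleigh fading). There is no direct link between sources and destinations. First hop: each relay $r$ schedules, by feeding back its index, a source with the largest gain $\gamma_{i,r}$. All scheduled sources, which form the set $\mathcal K$, transmit simultaneously at rate $1$ bit/s/Hz. The transmission of source $i\in\mathcal K$, scheduled by relay $r$, is received by $r$ if $$\frac{\gamma_{i,r}}{1/\rho+\sum_{t\in\mathcal K,\,t\ne i}\gamma_{t,r}}\ge 1 .$$ Let $R_1(n,m)$ be the expected number of sources that are received by some relay that scheduled them. Second hop: destination $j$ feeds back the index $k$ to relay $k$ if $$\frac{\xi_{k,j}}{1/\rho_R+\sum_{\ell\ne k}\xi_{\ell,j}}\ge 1 ,$$ the sum being over all the other relays. Each relay that received at least one feedback message chooses one of the destinations that sent it a message uniformly at random and transmits to it at rate $1$ bit/s/Hz; the transmission is successful if its SINR, with the other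 transmitting relays as interference, is at least $1$. Let $R_2(n,m)$ be the expected number of successful transmissions. The two hops alternate in time, so the average throughput of this decentralized two-hop opportunistic relaying scheme is $R(n,m)=\tfrac12\min\{R_1(n,m),R_2(n,m)\}$. Theorem 4. For every $n\ge1$ the maximum $R^*(n)=\max_{m\ge1}R(n,m)$ over the number of relays exists, and $$R^*(n)=\Theta(\log n)\qquad(n\to\infty),$$ that is, for some constants $0<c\le C$ (which may depend on $\rho$ and $\rho_R$) one has $c\log n\le R^*(n)\le C\log n$ for all sufficiently large $n$. -/

import Mathlib

open MeasureTheory ProbabilityTheory Filter Asymptotics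

namespace TwoHop

/-- The law of an `a × b` array of i.i.d. Rayleigh-fading power gains: independent `Exp(1)`
entries, row index = transmitter, column index = receiver. -/
noncomputable def channelLaw (a b : ℕ) : Measure (Fin a → Fin b → ℝ) :=
  Measure.pi fun _ => Measure.pi fun _ => expMeasure 1

/-- SINR at receiver `r` for the signal of transmitter `i`, when the transmitters in `A` are
active, the channel gains are `g` and the average SNR is `ρ`; all active transmitters other
than `i` are treated as noise. -/
noncomputable def sinr {a b : ℕ} (ρ : ℝ) (g : Fin a → Fin b → ℝ) (A : Finset (Fin a))
    (i : Fin a) (r : Fin b) : ℝ :=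
  g i r / (1 / ρ + ∑ t ∈ A.erase i, g t r)

/-! ### First hop: `n` sources, `m` relays, gains `γ i r` -/

/-- Relay `r` feeds back the index `i`: source `i` has the largest gain to relay `r`
(almost surely there is exactly one such source when there is a source at all). -/
def Schedules {n m : ℕ} (γ : Fin n → Fin m → ℝ) (r : Fin m) (i : Fin n) : Prop :=
  ∀ t, γ t r ≤ γ i r

open Classical in
/-- The set of sources scheduled by at least one relay; they all transmit. -/
noncomputable def scheduledSources {n m : ℕ} (γ : Fin n → Fin m → ℝ) : Finset (Fin n) :=
  {i | ∃ r, Schedules γ r i}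

open Classical in
/-- The scheduled sources that are successfully received (SINR at least `1`) by a relay that
scheduled them. A source scheduled by several relays is counted once. -/
noncomputable def decodedSources {n m : ℕ} (ρ : ℝ) (γ : Fin n → Fin m → ℝ) : Finset (Fin n) :=
  {i | ∃ r, Schedules γ r i ∧ 1 ≤ sinr ρ γ (scheduledSources γ) i r}

/-- Average throughput of the first hop in bits/s/Hz (every link has rate `1`). -/
noncomputable def firstHopThroughput (ρ : ℝ) (n m : ℕ) : ℝ :=
  ∫ γ, ((decodedSources ρ γ).card : ℝ) ∂(channelLaw n m)

/-! ### Second hop: `m` relays, `n` destinations, gains `ξ k j` -/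

open Classical in
/-- The destinations that feed back the index `k`: those whose SINR for relay `k`, computed as if
all the other relays were interfering, is at least `1`. (For nonnegative gains and positive SNR
a destination feeds back at most one index.) -/
noncomputable def requests {m n : ℕ} (ρR : ℝ) (ξ : Fin m → Fin n → ℝ) (k : Fin m) :
    Finset (Fin n) :=
  {j | 1 ≤ sinr ρR ξ Finset.univ k j}

open Classical in
/-- The relays that receive feedback; exactly these transmit in the second hop. -/
noncomputable def activeRelays {m n : ℕ} (ρR : ℝ) (ξ : Fin m → Fin n → ℝ) : Finset (Fin m) :=
  {k | (requests ρR ξ k).Nonempty}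

open Classical in
/-- The destinations requesting relay `k` at which the transmission of relay `k` would be received
successfully (SINR at least `1`) while the active relays transmit. -/
noncomputable def goodRequests {m n : ℕ} (ρR : ℝ) (ξ : Fin m → Fin n → ℝ) (k : Fin m) :
    Finset (Fin n) :=
  {j ∈ requests ρR ξ k | 1 ≤ sinr ρR ξ (activeRelays ρR ξ) k j}

/-- Expected number of successful transmissions in the second hop for given channel gains: every
active relay chooses one of the destinations that requested it uniformly at random. -/
noncomputable def deliveredRate {m n : ℕ} (ρR : ℝ) (ξ : Fin m → Fin n → ℝ) : ℝ :=
  ∑ k ∈ activeRelays ρR ξ, ((goodRequests ρR ξ k).card : ℝ) / ((requests ρR ξ k).card : ℝ)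

/-- Average throughput of the second hop in bits/s/Hz (every link has rate `1`). -/
noncomputable def secondHopThroughput (ρR : ℝ) (n m : ℕ) : ℝ :=
  ∫ ξ, deliveredRate ρR ξ ∂(channelLaw m n)

/-! ### The two-hop scheme -/

/-- Average throughput of the two-hop scheme with `n` source-destination pairs and `m` relays; the
two hops occupy alternate time slots. -/
noncomputable def throughput (ρ ρR : ℝ) (n m : ℕ) : ℝ :=
  1 / 2 * min (firstHopThroughput ρ n m) (secondHopThroughput ρR n m)

/-- The throughput of the scheme maximized over the number `m ≥ 1` of relays. -/
noncomputable def maxThroughput (ρ ρR : ℝ) (n : ℕ) : ℝ :=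
  sSup (throughput ρ ρR n '' Set.Ici 1)

end TwoHop

namespace TwoHop

open scoped ENNReal

/-! The second hop caps the useful number of relays at order `log n`. A destination requests a given
relay with probability `p = exp(-1/ρR) * 2^(-(m-1))`, because the relay's gain must exceed the noise
plus `m - 1` independent exponentials. Requests already allow for interference from every relay, so
each active relay succeeds and the second-hop throughput is exactly `m * (1 - (1 - p)^n)`
(`secondHopThroughput_eq`). It is at most `m` and at most `m * n * 2^(-(m-1))`, hence `O(log n)`
uniformly in `m`. For fixed `n` it tends to zero as `m` grows, so the maximum is attained.

For the lower bound, take `m` to be a small multiple of `log n`. Then `n * p` is large and almost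
all relays are active. In the first hop the best gain at a relay typically exceeds `T = log n / 2`,
while the other scheduled sources are chosen independently of their gains there and interfere with
mean at most `m`. Markov's inequality and a union bound (`measureReal_failureEvent_le`) show that
each relay decodes a source of its own with probability at least `1/2`. -/

instance : IsProbabilityMeasure (expMeasure 1) := isProbabilityMeasure_expMeasure one_pos

instance : NullSingletonClass (expMeasure 1) := by
  unfold expMeasure gammaMeasure; infer_instance

instance (a b : ℕ) : IsProbabilityMeasure (channelLaw a b) := by
  unfold channelLaw; infer_instance

/-- The law of `n` independent `Exp(1)` power gains. -/
noncomputable abbrev columnLaw (n : ℕ) : Measure (Fin n → ℝ) :=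
  Measure.pi fun _ => expMeasure 1

/-! ### Integrals and tails of the exponential law -/

theorem lintegral_expMeasure_one {f : ℝ → ℝ≥0∞} (hf : Measurable f) :
    ∫⁻ x, f x ∂(expMeasure 1) = ∫⁻ x in Set.Ioi 0, f x * ENNReal.ofReal (Real.exp (-x)) := by
  have h : expMeasure 1 = volume.withDensity (exponentialPDF 1) := rfl
  have hm : Measurable (exponentialPDF 1) := (measurable_exponentialPDFReal 1).ennreal_ofReal
  rw [h, lintegral_withDensity_eq_lintegral_mul _ hm hf, ← setLIntegral_congr Ioi_ae_eq_Ici.symm,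
    ← lintegral_indicator measurableSet_Ici]
  refine lintegral_congr fun x => ?_
  by_cases hx : 0 ≤ x
  · simp [Set.indicator, hx, exponentialPDF_eq, mul_comm]
  · simp [Set.indicator, hx, exponentialPDF_eq]

theorem ae_nonneg_expMeasure_one : ∀ᵐ x ∂(expMeasure 1), 0 ≤ x := by
  have hs : {x : ℝ | ¬ 0 ≤ x} = Set.Iio 0 := by ext; simp
  rw [ae_iff, hs, ← lintegral_indicator_one measurableSet_Iio,
    lintegral_expMeasure_one (measurable_one.indicator measurableSet_Iio)]
  rw [setLIntegral_congr_fun measurableSet_Ioi (g := fun _ => 0)]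
  · simp
  · intro x hx
    have : 0 ≤ x := le_of_lt hx
    simp [this]

theorem lintegral_id_expMeasure_one : ∫⁻ x, ENNReal.ofReal x ∂(expMeasure 1) = 1 := by
  rw [lintegral_expMeasure_one ENNReal.measurable_ofReal]
  have h1 := Real.Gamma_eq_integral (s := 2) two_pos
  have h2 := Real.GammaIntegral_convergent (s := 2) two_pos
  rw [setLIntegral_congr_fun measurableSet_Ioi
    (g := fun x => ENNReal.ofReal (Real.exp (-x) * x ^ ((2 : ℝ) - 1)))]
  · rw [← ofReal_integral_eq_lintegral_ofReal h2, ← h1, Real.Gamma_two, ENNReal.ofReal_one]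
    refine (ae_restrict_iff' measurableSet_Ioi).2 (.of_forall fun x hx => ?_)
    have : (0 : ℝ) < x := hx
    positivity
  · intro x hx
    have : (0 : ℝ) < x := hx
    have h : (2 : ℝ) - 1 = 1 := by norm_num
    simp only [h, Real.rpow_one]
    rw [← ENNReal.ofReal_mul this.le, mul_comm]

theorem lintegral_exp_neg_expMeasure_one :
    ∫⁻ x, ENNReal.ofReal (Real.exp (-x)) ∂(expMeasure 1) = ENNReal.ofReal (1 / 2) := by
  rw [lintegral_expMeasure_one (by fun_prop)]
  rw [setLIntegral_congr_fun measurableSet_Ioi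
    (g := fun x => ENNReal.ofReal (Real.exp (-2 * x)))]
  · rw [← ofReal_integral_eq_lintegral_ofReal (integrableOn_exp_mul_Ioi (by norm_num) 0),
      integral_exp_mul_Ioi (by norm_num)]
    · norm_num
    · exact .of_forall fun x => (Real.exp_pos _).le
  · intro x _
    simp only
    rw [← ENNReal.ofReal_mul (Real.exp_pos _).le, ← Real.exp_add]
    ring_nf

theorem expMeasure_one_Ici {x : ℝ} (hx : 0 ≤ x) :
    expMeasure 1 (Set.Ici x) = ENNReal.ofReal (Real.exp (-x)) := by
  have h := cdf_expMeasure_eq one_pos x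
  rw [cdf_eq_real, if_pos hx, one_mul] at h
  rw [← ofReal_measureReal, ← Set.compl_Iio, measureReal_compl measurableSet_Iio,
    measureReal_congr Iio_ae_eq_Iic, h]
  simp

theorem expMeasure_one_Iio {x : ℝ} (hx : 0 ≤ x) :
    expMeasure 1 (Set.Iio x) = ENNReal.ofReal (1 - Real.exp (-x)) := by
  have h := cdf_expMeasure_eq one_pos x
  rw [cdf_eq_real, if_pos hx, one_mul] at h
  rw [← ofReal_measureReal, measureReal_congr Iio_ae_eq_Iic, h]

/-! ### Rows and columns of the channel matrix -/

/-- Exchanging the roles of transmitters and receivers preserves the channel law. -/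
theorem measurePreserving_flip (a b : ℕ) :
    MeasurePreserving (fun (g : Fin a → Fin b → ℝ) j i => g i j) (channelLaw a b)
      (channelLaw b a) := by
  have hm : Measurable (fun (g : Fin a → Fin b → ℝ) j i => g i j) := by fun_prop
  refine ⟨hm, Eq.symm ?_⟩
  -- Boxes of boxes form a generating π-system; on them both laws give the same double product, up
  -- to the order of its factors.
  refine Measure.pi_eq_generateFrom
    (C := fun _ => Set.pi Set.univ '' Set.pi Set.univ fun _ => {s : Set ℝ | MeasurableSet s})
    (fun _ => generateFrom_pi) (fun _ => isPiSystem_pi)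
    (fun _ => Measure.FiniteSpanningSetsIn.pi fun _ => Measure.toFiniteSpanningSetsIn _) ?_
  intro s hs
  choose t ht hts using hs
  have hmt : ∀ j i, MeasurableSet (t j i) := fun j i => ht j i (Set.mem_univ i)
  have hms : ∀ j, MeasurableSet (s j) := fun j => by
    rw [← hts j]; exact MeasurableSet.univ_pi (hmt j)
  rw [Measure.map_apply hm (MeasurableSet.univ_pi hms)]
  have : (fun (g : Fin a → Fin b → ℝ) j i => g i j) ⁻¹' Set.univ.pi s
      = Set.univ.pi fun i => Set.univ.pi fun j => t j i := by
    ext g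
    simp only [← hts, Set.mem_preimage, Set.mem_univ_pi]
    exact forall_comm
  rw [this, channelLaw, Measure.pi_pi]
  simp_rw [← hts, Measure.pi_pi]
  exact Finset.prod_comm

theorem ae_nonneg_columnLaw (n : ℕ) : ∀ᵐ v ∂(columnLaw n), ∀ i, 0 ≤ v i :=
  ae_all_iff.2 fun i =>
    (measurePreserving_eval (fun _ : Fin n => expMeasure 1) i).quasiMeasurePreserving.ae
      ae_nonneg_expMeasure_one

theorem ae_nonneg_channelLaw (a b : ℕ) : ∀ᵐ g ∂(channelLaw a b), ∀ i j, 0 ≤ g i j :=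
  ae_all_iff.2 fun i =>
    (measurePreserving_eval (fun _ : Fin a => columnLaw b) i).quasiMeasurePreserving.ae
      (ae_nonneg_columnLaw b)

/-- Each column of the channel matrix consists of independent `Exp(1)` gains. -/
theorem measurePreserving_column {a b : ℕ} (r : Fin b) :
    MeasurePreserving (fun (g : Fin a → Fin b → ℝ) i => g i r) (channelLaw a b) (columnLaw a) :=
  (measurePreserving_eval (fun _ : Fin b => columnLaw a) r).comp (measurePreserving_flip a b)

/-- Distinct columns of the channel matrix are independent. -/
theorem indepFun_column {a b : ℕ} {r s : Fin b} (h : r ≠ s) :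
    IndepFun (fun (g : Fin a → Fin b → ℝ) i => g i r) (fun g i => g i s) (channelLaw a b) := by
  have h1 : IndepFun (fun ω : Fin b → Fin a → ℝ => ω r) (fun ω => ω s) (channelLaw b a) :=
    (iIndepFun_pi (μ := fun _ : Fin b => columnLaw a) (X := fun _ => id)
      fun _ => aemeasurable_id).indepFun h
  have hf := measurePreserving_flip a b
  rw [IndepFun_iff_Indep, Indep_iff] at h1 ⊢
  rintro _ _ ⟨A, hA, rfl⟩ ⟨B, hB, rfl⟩
  have hA' : MeasurableSet ((fun ω : Fin b → Fin a → ℝ => ω r) ⁻¹' A) := measurable_pi_apply r hA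
  have hB' : MeasurableSet ((fun ω : Fin b → Fin a → ℝ => ω s) ⁻¹' B) := measurable_pi_apply s hB
  have := h1 _ _ ⟨A, hA, rfl⟩ ⟨B, hB, rfl⟩
  rw [← hf.measure_preimage (hA'.inter hB').nullMeasurableSet,
    ← hf.measure_preimage hA'.nullMeasurableSet,
    ← hf.measure_preimage hB'.nullMeasurableSet] at this
  exact this

/-! ### Second hop: exact throughput and its bounds -/

/-- Given the other coordinates `y`, the exponential tail gives `exp(-c) * ∏ exp(-y i)`; each of the
`m - 1` independent factors has mean `1/2`. -/
theorem columnLaw_coord_sum_le {m : ℕ} (k : Fin m) {c : ℝ} (hc : 0 ≤ c) :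
    columnLaw m {v | c + ∑ t ∈ Finset.univ.erase k, v t ≤ v k}
      = ENNReal.ofReal (Real.exp (-c) * (1 / 2) ^ (m - 1)) := by
  obtain _ | m := m
  · exact k.elim0
  set S : Set (ℝ × (Fin m → ℝ)) := {p | c + ∑ i, p.2 i ≤ p.1} with hS
  have hSm : MeasurableSet S := measurableSet_le (by fun_prop) (by fun_prop)
  have hmp := measurePreserving_piFinSuccAbove (fun _ : Fin (m + 1) => expMeasure 1) k
  have hpre : {v : Fin (m + 1) → ℝ | c + ∑ t ∈ Finset.univ.erase k, v t ≤ v k}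
      = MeasurableEquiv.piFinSuccAbove (fun _ => ℝ) k ⁻¹' S := by
    ext v
    have h1 := Finset.add_sum_erase Finset.univ v (Finset.mem_univ k)
    rw [Fin.sum_univ_succAbove v k] at h1
    have h2 : ∑ t ∈ Finset.univ.erase k, v t = ∑ i, v (k.succAbove i) := by linarith
    rw [Set.mem_ofPred_eq, h2]
    rfl
  rw [hpre, hmp.measure_preimage hSm.nullMeasurableSet, Measure.prod_apply_symm hSm]
  have hexp : ∀ᵐ y ∂(columnLaw m), expMeasure 1 ((fun x => (x, y)) ⁻¹' S)
      = ENNReal.ofReal (Real.exp (-c)) * ENNReal.ofReal (∏ i, Real.exp (-y i)) := by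
    filter_upwards [ae_nonneg_columnLaw m] with y hy
    have : (fun x => (x, y)) ⁻¹' S = Set.Ici (c + ∑ i, y i) := rfl
    rw [this, expMeasure_one_Ici (add_nonneg hc (Finset.sum_nonneg fun i _ => hy i)),
      ← ENNReal.ofReal_mul (Real.exp_pos _).le, ← Real.exp_sum, ← Real.exp_add]
    simp [Finset.sum_neg_distrib, add_comm]
  have hint1 : Integrable (fun x : ℝ => Real.exp (-x)) (expMeasure 1) := by
    refine ⟨by fun_prop, ?_⟩
    rw [hasFiniteIntegral_iff_ofReal (.of_forall fun x => (Real.exp_pos _).le),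
      lintegral_exp_neg_expMeasure_one]
    exact ENNReal.ofReal_lt_top
  have hval : ∫ x, Real.exp (-x) ∂(expMeasure 1) = 1 / 2 := by
    rw [integral_eq_lintegral_of_nonneg_ae (.of_forall fun x => (Real.exp_pos _).le) (by fun_prop),
      lintegral_exp_neg_expMeasure_one]
    norm_num
  have hint : Integrable (fun y : Fin m → ℝ => ∏ i, Real.exp (-y i)) (columnLaw m) :=
    Integrable.fintype_prod (f := fun _ x => Real.exp (-x)) fun _ => hint1
  change ∫⁻ y, expMeasure 1 ((fun x => (x, y)) ⁻¹' S) ∂(columnLaw m) = _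
  rw [lintegral_congr_ae hexp, lintegral_const_mul _ (by fun_prop),
    ← ofReal_integral_eq_lintegral_ofReal hint
      (.of_forall fun y => Finset.prod_nonneg fun i _ => (Real.exp_pos _).le),
    integral_fintype_prod_eq_prod (f := fun _ x => Real.exp (-x)), hval,
    ← ENNReal.ofReal_mul (Real.exp_pos _).le]
  simp

theorem one_le_sinr_iff {a b : ℕ} {ρ : ℝ} (hρ : 0 < ρ) {g : Fin a → Fin b → ℝ}
    (hg : ∀ i r, 0 ≤ g i r) (A : Finset (Fin a)) (i : Fin a) (r : Fin b) :
    1 ≤ sinr ρ g A i r ↔ 1 / ρ + ∑ t ∈ A.erase i, g t r ≤ g i r := by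
  have h : 0 < 1 / ρ + ∑ t ∈ A.erase i, g t r :=
    add_pos_of_pos_of_nonneg (by positivity) (Finset.sum_nonneg fun t _ => hg t r)
  rw [sinr, one_le_div h]

/-- A request presumes that all relays interfere. Silencing some of them only raises the SINR, so
every request is good and each ratio is `1`. -/
theorem deliveredRate_eq_card {m n : ℕ} {ρR : ℝ} (hρR : 0 < ρR) {ξ : Fin m → Fin n → ℝ}
    (hξ : ∀ k j, 0 ≤ ξ k j) : deliveredRate ρR ξ = (activeRelays ρR ξ).card := by
  have hgood : ∀ k, goodRequests ρR ξ k = requests ρR ξ k := by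
    intro k
    refine Finset.filter_true_of_mem fun j hj => ?_
    have hj' : 1 ≤ sinr ρR ξ Finset.univ k j := (Finset.mem_filter.1 hj).2
    rw [one_le_sinr_iff hρR hξ] at hj' ⊢
    refine le_trans (add_le_add le_rfl ?_) hj'
    exact Finset.sum_le_sum_of_subset_of_nonneg
      (Finset.erase_subset_erase _ (Finset.subset_univ _)) fun t _ _ => hξ t j
  rw [deliveredRate, Finset.card_eq_sum_ones, Nat.cast_sum]
  refine Finset.sum_congr rfl fun k hk => ?_
  have hne : (requests ρR ξ k).Nonempty := (Finset.mem_filter.1 hk).2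
  rw [hgood, div_self (Nat.cast_ne_zero.2 hne.card_pos.ne'), Nat.cast_one]

/-- The gains from all relays to a destination for which the destination requests relay `k`. -/
def requestRegion (ρR : ℝ) {m : ℕ} (k : Fin m) : Set (Fin m → ℝ) :=
  {v | 1 ≤ v k / (1 / ρR + ∑ t ∈ Finset.univ.erase k, v t)}

theorem measurableSet_requestRegion (ρR : ℝ) {m : ℕ} (k : Fin m) :
    MeasurableSet (requestRegion ρR k) :=
  measurableSet_le (by fun_prop) (by fun_prop)

/-- The probability that a destination requests a given relay. -/
noncomputable def requestProb (ρR : ℝ) (m : ℕ) : ℝ := Real.exp (-(1 / ρR)) * (1 / 2) ^ (m - 1)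

theorem requestProb_pos (ρR : ℝ) (m : ℕ) : 0 < requestProb ρR m := by
  unfold requestProb; positivity

theorem requestProb_le {ρR : ℝ} (hρR : 0 < ρR) (m : ℕ) :
    requestProb ρR m ≤ (1 / 2) ^ (m - 1) := by
  have : Real.exp (-(1 / ρR)) ≤ 1 := Real.exp_le_one_iff.2 (by simp [hρR.le])
  exact mul_le_of_le_one_left (by positivity) this

theorem requestProb_le_one {ρR : ℝ} (hρR : 0 < ρR) (m : ℕ) : requestProb ρR m ≤ 1 :=
  (requestProb_le hρR m).trans (pow_le_one₀ (by norm_num) (by norm_num))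

theorem measure_requestRegion {ρR : ℝ} (hρR : 0 < ρR) {m : ℕ} (k : Fin m) :
    columnLaw m (requestRegion ρR k) = ENNReal.ofReal (requestProb ρR m) := by
  rw [requestProb, ← columnLaw_coord_sum_le k (by positivity : 0 ≤ 1 / ρR)]
  refine measure_congr ?_
  filter_upwards [ae_nonneg_columnLaw m] with v hv
  have h : 0 < 1 / ρR + ∑ t ∈ Finset.univ.erase k, v t :=
    add_pos_of_pos_of_nonneg (by positivity) (Finset.sum_nonneg fun t _ => hv t)
  exact propext (one_le_div h)

theorem mem_activeRelays {m n : ℕ} {ρR : ℝ} {ξ : Fin m → Fin n → ℝ} {k : Fin m} :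
    k ∈ activeRelays ρR ξ ↔ ∃ j, (fun t => ξ t j) ∈ requestRegion ρR k := by
  simp [activeRelays, Finset.Nonempty, requests, sinr, requestRegion]

theorem measurableSet_mem_activeRelays (ρR : ℝ) {m : ℕ} (n : ℕ) (k : Fin m) :
    MeasurableSet {ξ : Fin m → Fin n → ℝ | k ∈ activeRelays ρR ξ} := by
  simp_rw [mem_activeRelays, Set.ofPred_exists]
  exact .iUnion fun j => measurableSet_preimage (by fun_prop) (measurableSet_requestRegion ρR k)

/-- A relay is idle exactly when all `n` destinations, whose columns are independent, fail to
request it. -/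
theorem measureReal_mem_activeRelays {ρR : ℝ} (hρR : 0 < ρR) {m : ℕ} (n : ℕ) (k : Fin m) :
    (channelLaw m n).real {ξ | k ∈ activeRelays ρR ξ} = 1 - (1 - requestProb ρR m) ^ n := by
  have hm := measurableSet_mem_activeRelays ρR n k
  have hbox : MeasurableSet (Set.univ.pi fun _ : Fin n => (requestRegion ρR k)ᶜ) :=
    MeasurableSet.univ_pi fun _ => (measurableSet_requestRegion ρR k).compl
  have hc : {ξ : Fin m → Fin n → ℝ | k ∈ activeRelays ρR ξ}ᶜ
      = (fun ξ j t => ξ t j) ⁻¹' Set.univ.pi fun _ : Fin n => (requestRegion ρR k)ᶜ := by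
    ext ξ
    simp [mem_activeRelays]
  have h := probReal_compl_eq_one_sub (μ := channelLaw m n) hm
  have hcol : (columnLaw m) (requestRegion ρR k)ᶜ = ENNReal.ofReal (1 - requestProb ρR m) := by
    rw [prob_compl_eq_one_sub (measurableSet_requestRegion ρR k), measure_requestRegion hρR,
      ENNReal.ofReal_sub _ (requestProb_pos ρR m).le, ENNReal.ofReal_one]
  have hp : 0 ≤ 1 - requestProb ρR m := sub_nonneg.2 (requestProb_le_one hρR m)
  rw [hc, measureReal_def, (measurePreserving_flip m n).measure_preimage hbox.nullMeasurableSet,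
    channelLaw, Measure.pi_pi, Finset.prod_const, Finset.card_univ, Fintype.card_fin, hcol,
    ← ENNReal.ofReal_pow hp, ENNReal.toReal_ofReal (pow_nonneg hp n)] at h
  change _ = 1 - (channelLaw m n).real _ at h
  linarith

theorem card_eq_sum_indicator {Ω ι : Type*} [Fintype ι] (S : Ω → Finset ι) (ω : Ω) :
    ((S ω).card : ℝ) = ∑ i, {ω | i ∈ S ω}.indicator (fun _ => (1 : ℝ)) ω := by
  classical
  simp [Set.indicator_apply]

theorem integrable_card {Ω ι : Type*} [MeasurableSpace Ω] [Fintype ι] (P : Measure Ω)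
    [IsFiniteMeasure P] (S : Ω → Finset ι) (hS : ∀ i, MeasurableSet {ω | i ∈ S ω}) :
    Integrable (fun ω => ((S ω).card : ℝ)) P := by
  simp_rw [card_eq_sum_indicator S]
  exact integrable_finsetSum _ fun i _ => (integrable_const _).indicator (hS i)

/-- The expected cardinality of a random finite set. -/
theorem integral_card_eq_sum {Ω ι : Type*} [MeasurableSpace Ω] [Fintype ι] (P : Measure Ω)
    [IsFiniteMeasure P] (S : Ω → Finset ι) (hS : ∀ i, MeasurableSet {ω | i ∈ S ω}) :
    ∫ ω, ((S ω).card : ℝ) ∂P = ∑ i, P.real {ω | i ∈ S ω} := by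
  simp_rw [card_eq_sum_indicator S]
  rw [integral_finsetSum _ fun i _ => (integrable_const _).indicator (hS i)]
  exact Finset.sum_congr rfl fun i _ => by simp [integral_indicator_const, hS i]

theorem secondHopThroughput_eq {ρR : ℝ} (hρR : 0 < ρR) (n m : ℕ) :
    secondHopThroughput ρR n m = m * (1 - (1 - requestProb ρR m) ^ n) := by
  have h : ∀ᵐ ξ ∂(channelLaw m n), deliveredRate ρR ξ = (activeRelays ρR ξ).card := by
    filter_upwards [ae_nonneg_channelLaw m n] with ξ hξ using deliveredRate_eq_card hρR hξ
  rw [secondHopThroughput, integral_congr_ae h,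
    integral_card_eq_sum _ _ (measurableSet_mem_activeRelays ρR n),
    Finset.sum_congr rfl fun k _ => measureReal_mem_activeRelays hρR n k]
  simp only [Finset.sum_const, Finset.card_univ, Fintype.card_fin, nsmul_eq_mul]

theorem secondHopThroughput_nonneg {ρR : ℝ} (hρR : 0 < ρR) (n m : ℕ) :
    0 ≤ secondHopThroughput ρR n m := by
  rw [secondHopThroughput_eq hρR]
  have := pow_le_one₀ (n := n) (sub_nonneg.2 (requestProb_le_one hρR m))
    (sub_le_self 1 (requestProb_pos ρR m).le)
  exact mul_nonneg (Nat.cast_nonneg m) (sub_nonneg.2 this)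

theorem secondHopThroughput_le_card {ρR : ℝ} (hρR : 0 < ρR) (n m : ℕ) :
    secondHopThroughput ρR n m ≤ m := by
  rw [secondHopThroughput_eq hρR]
  have := pow_nonneg (sub_nonneg.2 (requestProb_le_one hρR m)) n
  exact mul_le_of_le_one_right (Nat.cast_nonneg m) (by linarith)

theorem secondHopThroughput_le {ρR : ℝ} (hρR : 0 < ρR) (n m : ℕ) :
    secondHopThroughput ρR n m ≤ m * (n * (1 / 2) ^ (m - 1)) := by
  rw [secondHopThroughput_eq hρR]
  refine mul_le_mul_of_nonneg_left ?_ (Nat.cast_nonneg m)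
  have h1 := requestProb_le_one hρR m
  -- Bernoulli's inequality plays the role of the union bound over destinations.
  have h2 := one_add_mul_le_pow (a := -requestProb ρR m) (by linarith) n
  have h3 := mul_le_mul_of_nonneg_left (requestProb_le hρR m) (Nat.cast_nonneg (α := ℝ) n)
  have h4 : (1 + -requestProb ρR m) = 1 - requestProb ρR m := by ring
  rw [h4] at h2
  linarith

theorem le_secondHopThroughput {ρR : ℝ} (hρR : 0 < ρR) (n m : ℕ) :
    m * (1 - Real.exp (-(n * requestProb ρR m))) ≤ secondHopThroughput ρR n m := by
  rw [secondHopThroughput_eq hρR]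
  refine mul_le_mul_of_nonneg_left (sub_le_sub_left ?_ 1) (Nat.cast_nonneg m)
  rw [← mul_neg, Real.exp_nat_mul]
  exact pow_le_pow_left₀ (sub_nonneg.2 (requestProb_le_one hρR m)) (Real.one_sub_le_exp_neg _) n

/-! ### First hop: which source a relay schedules -/

/-- The gains from all sources to a relay for which the relay schedules source `i`. -/
def winRegion {n : ℕ} (i : Fin n) : Set (Fin n → ℝ) := {v | ∀ t, v t ≤ v i}

theorem measurableSet_winRegion {n : ℕ} (i : Fin n) : MeasurableSet (winRegion i) := by
  simp_rw [winRegion, Set.ofPred_forall]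
  exact .iInter fun t => measurableSet_le (by fun_prop) (by fun_prop)

/-- The joint law of two coordinates is a product of atomless laws, so the diagonal is null. -/
theorem columnLaw_tie {n : ℕ} {s t : Fin n} (h : s ≠ t) :
    columnLaw n {v | v s = v t} = 0 := by
  have hi : IndepFun (fun v : Fin n → ℝ => v s) (fun v => v t) (columnLaw n) :=
    (iIndepFun_pi (μ := fun _ : Fin n => expMeasure 1) (X := fun _ => id)
      fun _ => aemeasurable_id).indepFun h
  have hp := (indepFun_iff_map_prod_eq_prod_map_map (measurable_pi_apply s).aemeasurable
    (measurable_pi_apply t).aemeasurable).1 hi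
  have hs : (columnLaw n).map (fun v => v s) = expMeasure 1 :=
    (measurePreserving_eval (fun _ : Fin n => expMeasure 1) s).map_eq
  have ht : (columnLaw n).map (fun v => v t) = expMeasure 1 :=
    (measurePreserving_eval (fun _ : Fin n => expMeasure 1) t).map_eq
  have hd : MeasurableSet {p : ℝ × ℝ | p.1 = p.2} :=
    measurableSet_eq_fun measurable_fst measurable_snd
  have h0 : (columnLaw n) ((fun v => (v s, v t)) ⁻¹' {p : ℝ × ℝ | p.1 = p.2}) = 0 := by
    rw [← Measure.map_apply (by fun_prop) hd, hp, hs, ht, Measure.prod_apply hd]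
    have : ∀ x : ℝ, Prod.mk x ⁻¹' {p : ℝ × ℝ | p.1 = p.2} = {x} := by
      intro x; ext y; simp [eq_comm]
    simp [this]
  exact h0

theorem columnLaw_winRegion_congr {n : ℕ} (i j : Fin n) :
    columnLaw n (winRegion i) = columnLaw n (winRegion j) := by
  have h := measurePreserving_piCongrLeft (fun _ : Fin n => expMeasure 1) (Equiv.swap i j)
  rw [← h.measure_preimage (measurableSet_winRegion i).nullMeasurableSet]
  congr 1
  ext v
  have hv : ∀ t, (MeasurableEquiv.piCongrLeft (fun _ : Fin n => ℝ) (Equiv.swap i j)) v t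
      = v (Equiv.swap i j t) := by
    intro t
    rw [MeasurableEquiv.coe_piCongrLeft]
    simpa using Equiv.piCongrLeft_apply_apply (fun _ : Fin n => ℝ) (Equiv.swap i j) v
      (Equiv.swap i j t)
  simp only [winRegion, Set.mem_preimage, Set.mem_ofPred_eq, hv, Equiv.swap_apply_left]
  exact ⟨fun h t => by simpa using h (Equiv.swap i j t), fun h t => h _⟩

theorem sum_columnLaw_winRegion {n : ℕ} (hn : 1 ≤ n) :
    ∑ i, columnLaw n (winRegion i) = 1 := by
  have : Nonempty (Fin n) := ⟨⟨0, hn⟩⟩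
  have hd : Pairwise (Function.onFun (AEDisjoint (columnLaw n)) winRegion) := by
    intro i j hij
    refine measure_mono_null ?_ (columnLaw_tie hij)
    rintro v ⟨h1, h2⟩
    exact le_antisymm (h2 i) (h1 j)
  have hu : ⋃ i, winRegion (n := n) i = Set.univ := by
    refine Set.eq_univ_of_forall fun v => Set.mem_iUnion.2 ?_
    obtain ⟨i, hi⟩ := Finite.exists_max v
    exact ⟨i, hi⟩
  rw [← tsum_fintype (L := .unconditional _),
    ← measure_iUnion₀ hd fun i => (measurableSet_winRegion i).nullMeasurableSet,
    hu, measure_univ]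

/-- The win regions cover the space, overlap only in ties, and have equal measure by
exchangeability. -/
theorem columnLaw_winRegion {n : ℕ} (i : Fin n) :
    columnLaw n (winRegion i) = (n : ℝ≥0∞)⁻¹ := by
  have h := sum_columnLaw_winRegion (Nat.one_le_of_lt i.pos)
  rw [Finset.sum_congr rfl fun j _ => columnLaw_winRegion_congr j i] at h
  rw [Finset.sum_const, Finset.card_univ, Fintype.card_fin, nsmul_eq_mul] at h
  exact ENNReal.eq_inv_of_mul_eq_one_left ((mul_comm _ _).trans h)

theorem mem_scheduledSources {n m : ℕ} {γ : Fin n → Fin m → ℝ} {i : Fin n} :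
    i ∈ scheduledSources γ ↔ ∃ r, Schedules γ r i := by
  simp [scheduledSources]

theorem mem_decodedSources {n m : ℕ} {ρ : ℝ} {γ : Fin n → Fin m → ℝ} {i : Fin n} :
    i ∈ decodedSources ρ γ ↔
      ∃ r, Schedules γ r i ∧ 1 ≤ sinr ρ γ (scheduledSources γ) i r := by
  simp [decodedSources]

theorem measurableSet_schedules {n m : ℕ} (r : Fin m) (i : Fin n) :
    MeasurableSet {γ : Fin n → Fin m → ℝ | Schedules γ r i} :=
  (measurePreserving_column r).measurable (measurableSet_winRegion i)

theorem measurableSet_mem_scheduledSources {n m : ℕ} (i : Fin n) :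
    MeasurableSet {γ : Fin n → Fin m → ℝ | i ∈ scheduledSources γ} := by
  simp_rw [mem_scheduledSources, Set.ofPred_exists]
  exact .iUnion fun r => measurableSet_schedules r i

theorem measurable_sinr_scheduledSources {n m : ℕ} (ρ : ℝ) (i : Fin n) (r : Fin m) :
    Measurable fun γ : Fin n → Fin m → ℝ => sinr ρ γ (scheduledSources γ) i r := by
  -- Indicators turn the sum over a random index set into a fixed finite sum of measurable terms.
  have h : ∀ γ : Fin n → Fin m → ℝ, ∑ t ∈ (scheduledSources γ).erase i, γ t r
      = ∑ t ∈ Finset.univ.erase i,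
        {γ : Fin n → Fin m → ℝ | t ∈ scheduledSources γ}.indicator (fun γ => γ t r) γ := by
    intro γ
    classical
    simp_rw [Set.indicator_apply, Set.mem_ofPred_eq, ← Finset.sum_filter]
    refine Finset.sum_congr ?_ fun _ _ => rfl
    ext t
    simp [and_comm]
  simp_rw [sinr, h]
  refine Measurable.div (by fun_prop) (measurable_const.add ?_)
  exact Finset.measurable_fun_sum _ fun t _ =>
    Measurable.indicator (by fun_prop) (measurableSet_mem_scheduledSources t)

theorem measurableSet_mem_decodedSources {n m : ℕ} (ρ : ℝ) (i : Fin n) :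
    MeasurableSet {γ : Fin n → Fin m → ℝ | i ∈ decodedSources ρ γ} := by
  simp_rw [mem_decodedSources, Set.ofPred_exists]
  exact .iUnion fun r => (measurableSet_schedules r i).inter
    (measurableSet_le measurable_const (measurable_sinr_scheduledSources ρ i r))

/-! ### First hop: interference, failures and decoded sources -/

/-- An upper bound for the interference at relay `r` caused by the sources that other relays
schedule. -/
noncomputable def crossInterference {n m : ℕ} (r : Fin m) (γ : Fin n → Fin m → ℝ) : ℝ≥0∞ :=
  ∑ s ∈ Finset.univ.erase r, ∑ t,
    (winRegion t).indicator 1 (fun i => γ i s) * ENNReal.ofReal (γ t r)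

theorem measurable_crossInterference_term {n m : ℕ} (r s : Fin m) (t : Fin n) :
    Measurable fun γ : Fin n → Fin m → ℝ =>
      (winRegion t).indicator (1 : (Fin n → ℝ) → ℝ≥0∞) (fun i => γ i s)
        * ENNReal.ofReal (γ t r) := by
  refine Measurable.mul ?_ (by fun_prop)
  exact (measurable_one.indicator (measurableSet_winRegion t)).comp (by fun_prop)

theorem measurable_crossInterference {n m : ℕ} (r : Fin m) :
    Measurable (crossInterference (n := n) r) :=
  Finset.measurable_fun_sum _ fun s _ => Finset.measurable_fun_sum _ fun t _ =>
    measurable_crossInterference_term r s t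

/-- For `s ≠ r` the winner at `s` is independent of column `r`, whose gains have mean `1`. Since the
winning probabilities sum to `1`, each such relay contributes exactly `1`. -/
theorem lintegral_crossInterference_le {n m : ℕ} (hn : 1 ≤ n) (r : Fin m) :
    ∫⁻ γ, crossInterference r γ ∂(channelLaw n m) ≤ m := by
  have hterm : ∀ s ∈ Finset.univ.erase r, ∀ t : Fin n,
      ∫⁻ γ, (winRegion t).indicator 1 (fun i => γ i s) * ENNReal.ofReal (γ t r)
        ∂(channelLaw n m) = columnLaw n (winRegion t) := by
    intro s hs t
    have hw : Measurable ((winRegion t).indicator (1 : (Fin n → ℝ) → ℝ≥0∞)) :=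
      measurable_one.indicator (measurableSet_winRegion t)
    have hv : Measurable fun v : Fin n → ℝ => ENNReal.ofReal (v t) := by fun_prop
    have hind := (indepFun_column (a := n) (Finset.ne_of_mem_erase hs)).comp hw hv
    have hmul := lintegral_mul_eq_lintegral_mul_lintegral_of_indepFun
      (hw.comp (by fun_prop)) (hv.comp (by fun_prop)) hind
    refine hmul.trans ?_
    have h1 := (measurePreserving_column (a := n) s).lintegral_comp hw
    have h2 := (measurePreserving_column (a := n) r).lintegral_comp hv
    have h3 := (measurePreserving_eval (fun _ : Fin n => expMeasure 1) t).lintegral_comp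
      ENNReal.measurable_ofReal
    rw [lintegral_id_expMeasure_one] at h3
    simp only [Function.eval] at h3
    rw [h3] at h2
    simp only [Function.comp_def]
    rw [h1, h2, mul_one, lintegral_indicator_one (measurableSet_winRegion t)]
  simp only [crossInterference]
  rw [lintegral_finsetSum _ fun s _ => Finset.measurable_fun_sum _ fun t _ =>
    measurable_crossInterference_term r s t]
  have hsum : ∀ s ∈ Finset.univ.erase r,
      ∫⁻ γ, ∑ t, (winRegion t).indicator 1 (fun i => γ i s) * ENNReal.ofReal (γ t r)
        ∂(channelLaw n m) = 1 := by
    intro s hs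
    rw [lintegral_finsetSum _ fun t _ => measurable_crossInterference_term r s t,
      Finset.sum_congr rfl fun t _ => hterm s hs t, sum_columnLaw_winRegion hn]
  rw [Finset.sum_congr rfl hsum, Finset.sum_const, nsmul_eq_mul, mul_one]
  exact_mod_cast (Finset.card_le_univ _).trans (Fintype.card_fin m).le

theorem channelLaw_le_crossInterference {n m : ℕ} (hn : 1 ≤ n) (r : Fin m) {L : ℝ} (hL : 0 < L) :
    channelLaw n m {γ | ENNReal.ofReal L ≤ crossInterference r γ} ≤ ENNReal.ofReal (m / L) := by
  refine (meas_ge_le_lintegral_div (measurable_crossInterference r).aemeasurable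
    (ENNReal.ofReal_pos.2 hL).ne' ENNReal.ofReal_ne_top).trans ?_
  rw [ENNReal.ofReal_div_of_pos hL, ENNReal.ofReal_natCast]
  exact ENNReal.div_le_div_right (lintegral_crossInterference_le hn r) _

/-- If `r` schedules nobody but `i`, every interferer was scheduled by some other relay and so
occurs in the double sum. -/
theorem ofReal_interference_le {n m : ℕ} {γ : Fin n → Fin m → ℝ} (hγ : ∀ i j, 0 ≤ γ i j)
    {r : Fin m} {i : Fin n} (hi : ∀ t, t ≠ i → ¬ Schedules γ r t) :
    ENNReal.ofReal (∑ t ∈ (scheduledSources γ).erase i, γ t r) ≤ crossInterference r γ := by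
  rw [ENNReal.ofReal_sum_of_nonneg fun t _ => hγ t r, crossInterference, Finset.sum_comm]
  refine (Finset.sum_le_sum fun t ht => ?_).trans
    (Finset.sum_le_sum_of_subset (Finset.subset_univ ((scheduledSources γ).erase i)))
  obtain ⟨hti, ht⟩ := Finset.mem_erase.1 ht
  obtain ⟨s, hs⟩ := mem_scheduledSources.1 ht
  have hsr : s ≠ r := by rintro rfl; exact hi t hti hs
  refine le_trans ?_ (Finset.single_le_sum (fun _ _ => zero_le)
    (Finset.mem_erase.2 ⟨hsr, Finset.mem_univ s⟩))
  have hmem : (fun j => γ j s) ∈ winRegion t := hs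
  simp [Set.indicator_of_mem hmem]

theorem channelLaw_max_lt_le {n m : ℕ} (r : Fin m) {T : ℝ} (hT : 0 ≤ T) :
    channelLaw n m {γ | ∀ i, γ i r < T} ≤ ENNReal.ofReal (Real.exp (-(n * Real.exp (-T)))) := by
  have hbox : MeasurableSet (Set.univ.pi fun _ : Fin n => Set.Iio T) :=
    MeasurableSet.univ_pi fun _ => measurableSet_Iio
  have hpre : {γ : Fin n → Fin m → ℝ | ∀ i, γ i r < T}
      = (fun γ i => γ i r) ⁻¹' Set.univ.pi fun _ => Set.Iio T := by
    ext; simp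
  have h0 : 0 ≤ 1 - Real.exp (-T) := sub_nonneg.2 (Real.exp_le_one_iff.2 (by linarith))
  rw [hpre, (measurePreserving_column r).measure_preimage hbox.nullMeasurableSet, Measure.pi_pi,
    expMeasure_one_Iio hT, Finset.prod_const, Finset.card_univ, Fintype.card_fin,
    ← ENNReal.ofReal_pow h0]
  refine ENNReal.ofReal_le_ofReal ?_
  rw [← mul_neg, Real.exp_nat_mul]
  exact pow_le_pow_left₀ h0 (Real.one_sub_le_exp_neg _) n

/-- The probability that two relays schedule the same source. -/
theorem channelLaw_collision_le {n m : ℕ} {r s : Fin m} (h : r ≠ s) :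
    channelLaw n m {γ | ∃ i, Schedules γ r i ∧ Schedules γ s i} ≤ (n : ℝ≥0∞)⁻¹ := by
  obtain rfl | hn := Nat.eq_zero_or_pos n
  · simp
  have hpair : ∀ i : Fin n, channelLaw n m {γ | Schedules γ r i ∧ Schedules γ s i}
      = (n : ℝ≥0∞)⁻¹ * columnLaw n (winRegion i) := by
    intro i
    have hw := measurableSet_winRegion i
    have h1 := (indepFun_column (a := n) h).measure_inter_preimage_eq_mul _ _ hw hw
    rw [(measurePreserving_column r).measure_preimage hw.nullMeasurableSet,
      (measurePreserving_column s).measure_preimage hw.nullMeasurableSet] at h1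
    rw [← columnLaw_winRegion i, ← h1]
    rfl
  rw [Set.ofPred_exists]
  refine (measure_iUnion_fintype_le _ _).trans ?_
  rw [Finset.sum_congr rfl fun i _ => hpair i, ← Finset.mul_sum, sum_columnLaw_winRegion hn,
    mul_one]

/-- The channel realizations for which relay `r` need not contribute a decoded source of its own:
degenerate gains, no strong source, strong interference, or a shared source. -/
def failureEvent (ρ T : ℝ) {n m : ℕ} (r : Fin m) : Set (Fin n → Fin m → ℝ) :=
  {γ | ∃ i j, γ i j < 0} ∪ {γ | ∃ i t, i ≠ t ∧ γ i r = γ t r} ∪ {γ | ∀ i, γ i r < T} ∪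
    {γ | ENNReal.ofReal (T - 1 / ρ) ≤ crossInterference r γ} ∪
    {γ | ∃ s, s ≠ r ∧ ∃ i, Schedules γ r i ∧ Schedules γ s i}

theorem measurableSet_failureEvent (ρ T : ℝ) {n m : ℕ} (r : Fin m) :
    MeasurableSet (failureEvent ρ T r : Set (Fin n → Fin m → ℝ)) := by
  refine ((((?_ : MeasurableSet _).union ?_).union ?_).union ?_).union ?_
  · simp_rw [Set.ofPred_exists]
    exact .iUnion fun i => .iUnion fun j => measurableSet_lt (by fun_prop) measurable_const
  · simp_rw [Set.ofPred_exists]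
    exact .iUnion fun i => .iUnion fun t => (MeasurableSet.const _).inter
      (measurableSet_eq_fun (by fun_prop) (by fun_prop))
  · simp_rw [Set.ofPred_forall]
    exact .iInter fun i => measurableSet_lt (by fun_prop) measurable_const
  · exact measurableSet_le measurable_const (measurable_crossInterference r)
  · simp_rw [Set.ofPred_exists]
    refine .iUnion fun s => (MeasurableSet.const _).inter ?_
    change MeasurableSet {γ : Fin n → Fin m → ℝ | ∃ i, Schedules γ r i ∧ Schedules γ s i}
    rw [Set.ofPred_exists]
    exact .iUnion fun i => (measurableSet_schedules r i).inter (measurableSet_schedules s i)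

theorem measureReal_failureEvent_le {ρ T : ℝ} (hρ : 0 < ρ) (hT : 1 / ρ < T) {n m : ℕ}
    (hn : 1 ≤ n) (r : Fin m) :
    (channelLaw n m).real (failureEvent ρ T r)
      ≤ Real.exp (-(n * Real.exp (-T))) + m / (T - 1 / ρ) + m / n := by
  have hρ' : 0 < 1 / ρ := by positivity
  have hL : 0 < T - 1 / ρ := sub_pos.2 hT
  have h1 : channelLaw n m {γ | ∃ i j, γ i j < 0} = 0 := by
    have := ae_iff.1 (ae_nonneg_channelLaw n m)
    simpa using this
  have h2 : channelLaw n m {γ | ∃ i t, i ≠ t ∧ γ i r = γ t r} = 0 := by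
    simp_rw [Set.ofPred_exists]
    refine measure_iUnion_null fun i => measure_iUnion_null fun t => ?_
    by_cases hit : i = t
    · simp [hit]
    · have := (measurePreserving_column (a := n) r).quasiMeasurePreserving.preimage_null
        (columnLaw_tie hit)
      exact measure_mono_null (fun γ hγ => hγ.2) this
  have h5 : channelLaw n m {γ | ∃ s, s ≠ r ∧ ∃ i, Schedules γ r i ∧ Schedules γ s i}
      ≤ ENNReal.ofReal (m / n) := by
    rw [Set.ofPred_exists]
    refine (measure_iUnion_fintype_le _ _).trans ?_
    have : ∀ s ∈ Finset.univ, channelLaw n m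
        {γ | s ≠ r ∧ ∃ i, Schedules γ r i ∧ Schedules γ s i} ≤ (n : ℝ≥0∞)⁻¹ := by
      intro s _
      by_cases hs : s = r
      · simp [hs]
      · exact (measure_mono fun γ hγ => hγ.2).trans (channelLaw_collision_le (Ne.symm hs))
    refine (Finset.sum_le_card_nsmul _ _ _ this).trans ?_
    rw [ENNReal.ofReal_div_of_pos (by exact_mod_cast hn), ENNReal.ofReal_natCast,
      ENNReal.ofReal_natCast, Finset.card_univ, Fintype.card_fin, nsmul_eq_mul, div_eq_mul_inv]
  have h3 := channelLaw_max_lt_le (n := n) r (hρ'.le.trans hT.le)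
  have h4 := channelLaw_le_crossInterference hn r hL
  have h : channelLaw n m (failureEvent ρ T r) ≤
      ENNReal.ofReal (Real.exp (-(n * Real.exp (-T))) + m / (T - 1 / ρ) + m / n) := by
    rw [ENNReal.ofReal_add (by positivity) (by positivity),
      ENNReal.ofReal_add (by positivity) (by positivity)]
    refine (measure_union_le _ _).trans (add_le_add ?_ h5)
    refine (measure_union_le _ _).trans (add_le_add ?_ h4)
    refine (measure_union_le _ _).trans ?_
    rw [measure_union_null h1 h2, zero_add]
    exact h3
  exact ENNReal.toReal_le_of_le_ofReal (by positivity) h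

/-- The strongest source has gain at least `T`, while the interference is below `T - 1 / ρ`, so the
SINR is at least `1`. That no other relay schedules it makes the map from good relays to decoded
sources injective. -/
theorem exists_own_decoded {ρ T : ℝ} (hρ : 0 < ρ) {n m : ℕ} {r : Fin m}
    {γ : Fin n → Fin m → ℝ} (h : γ ∉ failureEvent ρ T r) :
    ∃ i ∈ decodedSources ρ γ, Schedules γ r i ∧ ∀ s, s ≠ r → ¬ Schedules γ s i := by
  simp only [failureEvent, Set.mem_union, not_or, Set.mem_ofPred_eq, not_exists, not_and,
    not_forall, not_lt, not_le] at h
  obtain ⟨⟨⟨⟨hnn, htie⟩, j, hj⟩, hI⟩, hcol⟩ := h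
  have : Nonempty (Fin n) := ⟨j⟩
  obtain ⟨i, hi⟩ := Finite.exists_max fun i => γ i r
  have hsched : Schedules γ r i := hi
  have hI' := (ofReal_interference_le hnn (r := r) (i := i) fun t hti ht =>
    htie t i hti (le_antisymm (hi t) (ht i))).trans_lt hI
  have hlt := (ENNReal.ofReal_lt_ofReal_iff'.1 hI').1
  refine ⟨i, mem_decodedSources.2 ⟨r, hsched, ?_⟩, hsched, fun s hs => hcol s hs i hsched⟩
  rw [one_le_sinr_iff hρ hnn]
  have := hi j
  linarith

theorem le_firstHopThroughput {ρ T : ℝ} (hρ : 0 < ρ) (hT : 1 / ρ < T) {n : ℕ} (hn : 1 ≤ n)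
    (m : ℕ) :
    m * (1 - (Real.exp (-(n * Real.exp (-T))) + m / (T - 1 / ρ) + m / n))
      ≤ firstHopThroughput ρ n m := by
  classical
  let S : (Fin n → Fin m → ℝ) → Finset (Fin m) := fun γ => {r | γ ∉ failureEvent ρ T r}
  have hS : ∀ r, {γ | r ∈ S γ} = (failureEvent ρ T r)ᶜ := fun r => by ext; simp [S]
  have hcard : ∀ γ, (S γ).card ≤ (decodedSources ρ γ).card := by
    intro γ
    have h : ∀ r ∈ S γ, ∃ i ∈ decodedSources ρ γ,
        Schedules γ r i ∧ ∀ s, s ≠ r → ¬ Schedules γ s i := fun r hr =>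
      exists_own_decoded hρ (by simpa [S] using hr)
    have : Nonempty (Fin n) := ⟨⟨0, hn⟩⟩
    choose! f hf hfs hfu using h
    refine Finset.card_le_card_of_injOn f hf fun r hr s hs hrs => ?_
    by_contra hne
    exact hfu r hr s (Ne.symm hne) (hrs ▸ hfs s hs)
  have hSm : ∀ r, MeasurableSet {γ | r ∈ S γ} := fun r => by
    rw [hS]; exact (measurableSet_failureEvent ρ T r).compl
  have hsum : ∀ i, MeasurableSet {γ : Fin n → Fin m → ℝ | i ∈ decodedSources ρ γ} :=
    measurableSet_mem_decodedSources ρ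
  have hmono : ∫ γ, ((S γ).card : ℝ) ∂(channelLaw n m) ≤ firstHopThroughput ρ n m :=
    integral_mono (integrable_card _ S hSm) (integrable_card _ _ hsum)
      fun γ => Nat.cast_le.2 (hcard γ)
  refine le_trans ?_ hmono
  rw [integral_card_eq_sum _ S hSm]
  have hle : ∀ r ∈ Finset.univ,
      1 - (Real.exp (-(n * Real.exp (-T))) + m / (T - 1 / ρ) + m / n)
        ≤ (channelLaw n m).real {γ | r ∈ S γ} := by
    intro r _
    rw [hS, probReal_compl_eq_one_sub (measurableSet_failureEvent ρ T r)]
    exact sub_le_sub_left (measureReal_failureEvent_le hρ hT hn r) 1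
  have := Finset.card_nsmul_le_sum _ _ _ hle
  simpa using this

/-! ### Existence of the maximum -/

theorem firstHopThroughput_nonneg (ρ : ℝ) (n m : ℕ) : 0 ≤ firstHopThroughput ρ n m :=
  integral_nonneg fun _ => Nat.cast_nonneg _

theorem throughput_nonneg {ρ ρR : ℝ} (hρR : 0 < ρR) (n m : ℕ) : 0 ≤ throughput ρ ρR n m :=
  mul_nonneg (by norm_num)
    (le_min (firstHopThroughput_nonneg ρ n m) (secondHopThroughput_nonneg hρR n m))

theorem throughput_le_secondHopThroughput {ρ ρR : ℝ} (hρR : 0 < ρR) (n m : ℕ) :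
    throughput ρ ρR n m ≤ secondHopThroughput ρR n m := by
  have h := min_le_right (firstHopThroughput ρ n m) (secondHopThroughput ρR n m)
  have := secondHopThroughput_nonneg hρR n m
  rw [throughput]
  linarith

theorem tendsto_throughput_zero {ρ ρR : ℝ} (hρR : 0 < ρR) (n : ℕ) :
    Tendsto (throughput ρ ρR n) atTop (nhds 0) := by
  have h : Tendsto (fun m : ℕ => 2 * n * (m * (1 / 2 : ℝ) ^ m)) atTop (nhds 0) := by
    simpa using (tendsto_self_mul_const_pow_of_lt_one (r := (1 / 2 : ℝ))
      (by norm_num) (by norm_num)).const_mul (2 * (n : ℝ))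
  refine squeeze_zero (throughput_nonneg hρR n) (fun m => ?_) h
  refine (throughput_le_secondHopThroughput hρR n m).trans
    ((secondHopThroughput_le hρR n m).trans ?_)
  -- At `m = 0` the exponent `m - 1` truncates, but the factor `m` makes both sides zero.
  obtain _ | k := m
  · simp
  · rw [Nat.add_sub_cancel, pow_succ]
    exact le_of_eq (by ring)

/-- A nonnegative sequence that tends to zero attains its maximum over the positive indices. -/
theorem exists_forall_ge_of_tendsto_zero {f : ℕ → ℝ} (h0 : ∀ m, 0 ≤ f m)
    (hf : Tendsto f atTop (nhds 0)) : ∃ m, 1 ≤ m ∧ ∀ k, 1 ≤ k → f k ≤ f m := by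
  by_cases hz : ∀ k, 1 ≤ k → f k ≤ 0
  · exact ⟨1, le_rfl, fun k hk => (hz k hk).trans (h0 1)⟩
  push Not at hz
  obtain ⟨p, hp, hfp⟩ := hz
  -- Beyond `N` all values lie below the positive value `f p`, so a maximum over a finite range
  -- containing `p` is global.
  obtain ⟨N, hN⟩ := eventually_atTop.1 (hf.eventually_lt_const hfp)
  obtain ⟨m, hm, hmax⟩ := (Finset.Icc 1 (max N p)).exists_max_image f
    ⟨p, Finset.mem_Icc.2 ⟨hp, le_max_right _ _⟩⟩
  refine ⟨m, (Finset.mem_Icc.1 hm).1, fun k hk => ?_⟩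
  obtain hkN | hkN := le_total N k
  · exact (hN k hkN).le.trans (hmax p (Finset.mem_Icc.2 ⟨hp, le_max_right _ _⟩))
  · exact hmax k (Finset.mem_Icc.2 ⟨hk, hkN.trans (le_max_left _ _)⟩)

theorem isGreatest_maxThroughput {ρ ρR : ℝ} (hρR : 0 < ρR) (n : ℕ) :
    IsGreatest (throughput ρ ρR n '' Set.Ici 1) (maxThroughput ρ ρR n) := by
  obtain ⟨m, hm, hmax⟩ := exists_forall_ge_of_tendsto_zero (throughput_nonneg (ρ := ρ) hρR n)
    (tendsto_throughput_zero hρR n)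
  have h : IsGreatest (throughput ρ ρR n '' Set.Ici 1) (throughput ρ ρR n m) := by
    refine ⟨⟨m, hm, rfl⟩, ?_⟩
    rintro _ ⟨k, hk, rfl⟩
    exact hmax k hk
  rw [maxThroughput, h.csSup_eq]
  exact h

/-! ### Logarithmic upper and lower bounds -/

theorem one_half_eq_exp : (1 / 2 : ℝ) = Real.exp (-Real.log 2) := by
  rw [Real.exp_neg, Real.exp_log two_pos, one_div]

/-- Up to `4 * log n + 1` relays the trivial bound `m` suffices; beyond that, the bound `m * n *
2^(-(m-1))` is at most `4`. -/
theorem secondHopThroughput_le_log {ρR : ℝ} (hρR : 0 < ρR) {n : ℕ} (hn : 1 ≤ Real.log n)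
    (m : ℕ) : secondHopThroughput ρR n m ≤ 5 * Real.log n := by
  obtain h | h := le_or_gt (m : ℝ) (4 * Real.log n + 1)
  · exact (secondHopThroughput_le_card hρR n m).trans (by linarith)
  obtain _ | k := m
  · simp only [Nat.cast_zero] at h; linarith
  push_cast at h
  have hn0 : (0 : ℝ) < n := by
    rcases Nat.eq_zero_or_pos n with rfl | h0
    · norm_num at hn
    · exact_mod_cast h0
  -- Since `log 2 > 1/2`, the decay splits into two factors `exp(-k/4)`: one absorbs `n`, the other
  -- absorbs `k + 1`.
  have hpow : (1 / 2 : ℝ) ^ k ≤ Real.exp (-(k / 4)) * Real.exp (-(k / 4)) := by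
    rw [one_half_eq_exp, ← Real.exp_nat_mul, ← Real.exp_add]
    refine Real.exp_le_exp.2 ?_
    have := Real.log_two_gt_d9
    nlinarith [Nat.cast_nonneg (α := ℝ) k]
  have hnk : n * Real.exp (-(k / 4)) ≤ 1 := by
    rw [← Real.exp_log hn0, ← Real.exp_add]
    exact Real.exp_le_one_iff.2 (by linarith)
  have hk : ((k : ℝ) + 1) * Real.exp (-(k / 4)) ≤ 4 := by
    rw [Real.exp_neg, ← div_eq_mul_inv, div_le_iff₀ (Real.exp_pos _)]
    linarith [Real.add_one_le_exp ((k : ℝ) / 4)]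
  have hmain := secondHopThroughput_le hρR n (k + 1)
  rw [Nat.add_sub_cancel] at hmain
  push_cast at hmain
  calc secondHopThroughput ρR n (k + 1) ≤ ((k : ℝ) + 1) * (n * (1 / 2) ^ k) := hmain
    _ ≤ ((k : ℝ) + 1) * (n * (Real.exp (-(k / 4)) * Real.exp (-(k / 4)))) := by gcongr
    _ = (((k : ℝ) + 1) * Real.exp (-(k / 4))) * (n * Real.exp (-(k / 4))) := by ring
    _ ≤ 4 * 1 := by gcongr
    _ ≤ 5 * Real.log n := by linarith

theorem exp_neg_exp_le {T : ℝ} (hT : 8 ≤ T) : Real.exp (-Real.exp T) ≤ 1 / 8 := by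
  rw [Real.exp_neg, ← one_div]
  refine one_div_le_one_div_of_le (by norm_num) ?_
  linarith [Real.add_one_le_exp (Real.exp T), Real.add_one_le_exp T]

/-- With `T = log n / 2` one has `n * exp(-T) = exp T`, and `m` is about `T / 8`. The three
first-hop failure terms are then at most `1/8`, `1/4` and `1/8`, so each hop delivers at least `m /
2`; halving for the alternation gives `m / 4 ≥ log n / 64`. -/
theorem le_throughput {ρ ρR : ℝ} (hρ : 0 < ρ) (hρR : 0 < ρR) {n : ℕ}
    (h1 : 32 + 4 / ρ + 4 / ρR ≤ Real.log n) :
    Real.log n / 64 ≤ throughput ρ ρR n (⌊Real.log n / 16⌋₊ + 1) := by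
  have hρ1 : 0 < 1 / ρ := by positivity
  have hρ2 : 0 < 1 / ρR := by positivity
  have e1 : 4 / ρ = 4 * (1 / ρ) := by ring
  have e2 : 4 / ρR = 4 * (1 / ρR) := by ring
  rw [e1, e2] at h1
  obtain ⟨T, hT⟩ : ∃ T, T = Real.log n / 2 := ⟨_, rfl⟩
  have hlog : Real.log n = 2 * T := by linarith
  obtain ⟨k, hk⟩ : ∃ k, k = ⌊Real.log n / 16⌋₊ := ⟨_, rfl⟩
  have hn : 1 ≤ n := by
    -- The convention `log 0 = 0` lets the lower bound on `log n` exclude `n = 0`.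
    rcases Nat.eq_zero_or_pos n with rfl | h0
    · simp only [Nat.cast_zero, Real.log_zero] at h1; linarith
    · exact h0
  have hnexp : (n : ℝ) = Real.exp (2 * T) := by
    rw [← hlog, Real.exp_log (by exact_mod_cast hn)]
  have hk1 : (k : ℝ) ≤ T / 8 := by
    rw [hk]
    exact (Nat.floor_le (by linarith)).trans (by linarith)
  have hk2 : T / 8 ≤ k + 1 := by
    rw [hk]
    exact le_trans (by linarith) (Nat.lt_floor_add_one (Real.log n / 16)).le
  have hm0 : (0 : ℝ) < k + 1 := by positivity
  have hfirst := le_firstHopThroughput hρ (by linarith : 1 / ρ < T) hn (k + 1)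
  have hsecond := le_secondHopThroughput hρR n (k + 1)
  have hexpT := exp_neg_exp_le (by linarith : 8 ≤ T)
  have a1 : Real.exp (-(n * Real.exp (-T))) ≤ 1 / 8 := by
    rw [hnexp, ← Real.exp_add]
    convert hexpT using 4
    ring
  have a2 : ((k + 1 : ℕ) : ℝ) / (T - 1 / ρ) ≤ 1 / 4 := by
    rw [div_le_iff₀ (by linarith)]
    push_cast
    linarith
  have a3 : ((k + 1 : ℕ) : ℝ) / n ≤ 1 / 8 := by
    rw [div_le_iff₀ (by exact_mod_cast hn), hnexp]
    push_cast
    linarith [Real.add_one_le_exp (2 * T)]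
  -- The exponent `2 * T - 1 / ρR - k * log 2` is at least `T`, because `k ≤ T / 8` and `T`
  -- dominates `1 / ρR`.
  have hnp : Real.exp T ≤ n * requestProb ρR (k + 1) := by
    rw [requestProb, Nat.add_sub_cancel, hnexp, one_half_eq_exp, ← Real.exp_nat_mul, ← Real.exp_add,
      ← Real.exp_add]
    refine Real.exp_le_exp.2 ?_
    have h3 := Real.log_two_lt_d9
    have h4 := mul_le_mul_of_nonneg_left (by linarith : Real.log 2 ≤ 1) (Nat.cast_nonneg (α := ℝ) k)
    rw [mul_neg]
    linarith
  have b1 : Real.exp (-(n * requestProb ρR (k + 1))) ≤ 1 / 8 :=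
    (Real.exp_le_exp.2 (neg_le_neg hnp)).trans hexpT
  push_cast at hfirst hsecond a2 a3
  have c1 : ((k : ℝ) + 1) * (1 / 2) ≤ firstHopThroughput ρ n (k + 1) :=
    le_trans (mul_le_mul_of_nonneg_left (by linarith) hm0.le) hfirst
  have c2 : ((k : ℝ) + 1) * (1 / 2) ≤ secondHopThroughput ρR n (k + 1) :=
    le_trans (mul_le_mul_of_nonneg_left (by linarith) hm0.le) hsecond
  have c3 := le_min c1 c2
  rw [← hk, throughput]
  linarith

end TwoHop

theorem theorem4 (ρ ρR : ℝ) (hρ : 0 < ρ) (hρR : 0 < ρR) :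
    (∀ n : ℕ, 1 ≤ n →
      IsGreatest (TwoHop.throughput ρ ρR n '' Set.Ici 1) (TwoHop.maxThroughput ρ ρR n)) ∧
    (fun n : ℕ => TwoHop.maxThroughput ρ ρR n) =Θ[atTop] (fun n : ℕ => Real.log (n : ℝ)) := by
  have hgreat := TwoHop.isGreatest_maxThroughput (ρ := ρ) hρR
  refine ⟨fun n _ => hgreat n, ?_⟩
  have hlog : Tendsto (fun n : ℕ => Real.log (n : ℝ)) atTop atTop :=
    Real.tendsto_log_atTop.comp tendsto_natCast_atTop_atTop
  have hnonneg : ∀ n, 0 ≤ TwoHop.maxThroughput ρ ρR n := fun n => by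
    obtain ⟨m, -, hm⟩ := (hgreat n).1
    exact hm ▸ TwoHop.throughput_nonneg hρR n m
  constructor
  · refine IsBigO.of_bound 5 ?_
    filter_upwards [hlog.eventually_ge_atTop 1] with n hn
    obtain ⟨m, -, hm⟩ := (hgreat n).1
    rw [Real.norm_of_nonneg (hnonneg n), Real.norm_of_nonneg (by linarith), ← hm]
    exact (TwoHop.throughput_le_secondHopThroughput hρR n m).trans
      (TwoHop.secondHopThroughput_le_log hρR hn m)
  · refine IsBigO.of_bound 64 ?_
    filter_upwards [hlog.eventually_ge_atTop (32 + 4 / ρ + 4 / ρR),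
      hlog.eventually_ge_atTop 1] with n hn hn1
    rw [Real.norm_of_nonneg (hnonneg n), Real.norm_of_nonneg (by linarith)]
    have h1 := TwoHop.le_throughput hρ hρR hn
    have h2 := (hgreat n).2 ⟨⌊Real.log n / 16⌋₊ + 1, Nat.le_add_left 1 _, rfl⟩
    linarith
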